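/- Let $\mathbb O=\mathbb H\oplus\mathbb H$ be the octonions, with multiplication $(q_1,q_2)(p_1,p_2)=(q_1p_1-\bar p_2q_2,\;p_2q_1+q_2\bar p_1)$, and identify $\mathbb O\times\mathbb O$ with $\mathbb R^{16}$. Let $U_1=\{1\}\times\mathbb O\times\mathbb O$, $U_2=\mathbb O\times\{1\}\times\mathbb O$, $U_3=\mathbb O\times\mathbb O\times\{1\}$ and $\mathcal U=U_1\cup U_2\cup U_3\subset\mathbb O^3$. On $\mathcal U$ let $(a,b,c)\sim(d,e,f)$ if and only if there is $\lambda\in\mathbb O\setminus\{0\}$ with $a=d\lambda$, $b=e\lambda$, $c=f\lambda$; this is an equivalence relation. Let $\mathbb O\mathrm P^2=\mathcal U/{\sim}$ be the octonionic projective plane, with the quotient topology, let $[a,b,c]$ denote the class of $(a,b,c)$, and let $U_i/{\sim}$ be the image of $U_i$. Then $\mathbb O\mathrm P^2$ is a simply connected smooth manifold of dimension $16$ (Hausdorff and second countable). More precisely: 1. The sets $U_i/{\sim}$ ($i=1,2,3$) are open and cover $\mathbb O\mathrm P^2$, and the maps $\phi_i:U_i/{\sim}\to\mathbb R^{16}$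 given by $\phi_1([1,b,c])=(b,c)$, $\phi_2([a,1,c])=(a,c)$, $\phi_3([a,b,1])=(a,b)$ are well-defined homeomorphisms onto $\mathbb R^{16}$. 2. The transition maps are $$\phi_1\circ\phi_2^{-1}(a,b)=\phi_2\circ\phi_1^{-1}(a,b)=(a^{-1},ba^{-1})\quad(a\neq0),$$ $$\phi_1\circ\phi_3^{-1}(a,b)=(ba^{-1},a^{-1})\quad(a\ne0),\qquad \phi_3\circ\phi_1^{-1}(a,b)=(b^{-1},ab^{-1})\quad(b\neq0),$$ $$\phi_2\circ\phi_3^{-1}(a,b)=\phi_3\circ\phi_2^{-1}(a,b)=(ab^{-1},b^{-1})\quad(b\neq0),$$ each with exactly the indicated domain, and the three charts $\phi_i$ form a smooth atlas of $\mathbb O\mathrm P^2$. 3. $\mathbb O\mathrm P^2$ is simply connected. 4. $U_1/{\sim}\cap U_2/{\sim}$ is homotopy equivalent to $S^7\times\mathbb R^8$, $U_1/{\sim}\cap U_2/{\sim}\cap U_3/{\sim}$ is homotopy equivalent to $S^7\times S^7$, and $(U_1/{\sim}\cup U_2/{\sim})\cap U_3/{\sim}$ is homotopy equivalent to $S^{15}$.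 -/

import Mathlib

open scoped Quaternion Manifold ContDiff

noncomputable section

/-- The octonions `𝕆 = ℍ ⊕ ℍ`, obtained from the quaternions by the Cayley-Dickson construction. -/
@[ext]
structure Octonion where
  /-- first quaternionic component -/
  fst : ℍ[ℝ]
  /-- second quaternionic component -/
  snd : ℍ[ℝ]

namespace Octonion

instance : Zero Octonion := ⟨⟨0, 0⟩⟩

instance : One Octonion := ⟨⟨1, 0⟩⟩

/-- `(q₁, q₂) * (p₁, p₂) = (q₁ p₁ - p̄₂ q₂, p₂ q₁ + q₂ p̄₁)`. -/
instance : Mul Octonion :=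
  ⟨fun q p => ⟨q.fst * p.fst - star p.snd * q.snd, p.snd * q.fst + q.snd * star p.fst⟩⟩

/-- The squared norm `|(q₁, q₂)|² = |q₁|² + |q₂|²`. -/
def normSq (q : Octonion) : ℝ := Quaternion.normSq q.fst + Quaternion.normSq q.snd

/-- `q⁻¹ = q̄ / |q|²`, where the conjugate of `(q₁, q₂)` is `(q̄₁, -q₂)`; in particular `0⁻¹ = 0`. -/
instance : Inv Octonion :=
  ⟨fun q => ⟨(normSq q)⁻¹ • star q.fst, -((normSq q)⁻¹ • q.snd)⟩⟩

/-- The topology of `ℍ × ℍ = ℝ⁸`. -/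
instance : TopologicalSpace Octonion :=
  TopologicalSpace.induced (fun q => (q.fst, q.snd)) inferInstance

theorem zero_def : (0 : Octonion) = ⟨0, 0⟩ := rfl

theorem one_def : (1 : Octonion) = ⟨1, 0⟩ := rfl

theorem mul_def (q p : Octonion) : q * p =
    ⟨q.fst * p.fst - star p.snd * q.snd, p.snd * q.fst + q.snd * star p.fst⟩ := rfl

theorem inv_def (q : Octonion) :
    q⁻¹ = ⟨(normSq q)⁻¹ • star q.fst, -((normSq q)⁻¹ • q.snd)⟩ := rfl

protected theorem one_mul (a : Octonion) : 1 * a = a := by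
  ext1 <;> simp [one_def, mul_def]

protected theorem mul_one (a : Octonion) : a * 1 = a := by
  ext1 <;> simp [one_def, mul_def]

protected theorem zero_mul (a : Octonion) : 0 * a = 0 := by
  ext1 <;> simp [zero_def, mul_def]

protected theorem mul_zero (a : Octonion) : a * 0 = 0 := by
  ext1 <;> simp [zero_def, mul_def]

theorem one_ne_zero : (1 : Octonion) ≠ 0 := by
  intro h
  simpa [one_def, zero_def] using congrArg (fun q => q.fst.re) h

theorem normSq_ne_zero {a : Octonion} (ha : a ≠ 0) : normSq a ≠ 0 := by
  intro h
  apply ha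
  have h1 : 0 ≤ Quaternion.normSq a.fst := Quaternion.normSq_nonneg
  have h2 : 0 ≤ Quaternion.normSq a.snd := Quaternion.normSq_nonneg
  unfold normSq at h
  ext1
  · exact Quaternion.normSq_eq_zero.1 (by linarith)
  · exact Quaternion.normSq_eq_zero.1 (by linarith)

theorem normSq_eq (a : Octonion) : normSq a =
    a.fst.re ^ 2 + a.fst.imI ^ 2 + a.fst.imJ ^ 2 + a.fst.imK ^ 2 +
      (a.snd.re ^ 2 + a.snd.imI ^ 2 + a.snd.imJ ^ 2 + a.snd.imK ^ 2) := by
  simp [normSq, Quaternion.normSq_def']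

/-- Right cancellation `(a b) b⁻¹ = a`. -/
theorem mul_mul_inv {b : Octonion} (hb : b ≠ 0) (a : Octonion) : a * b * b⁻¹ = a := by
  have h := normSq_ne_zero hb
  have e := normSq_eq b
  ext <;> simp [mul_def, inv_def] <;> field_simp <;> rw [e] <;> ring

/-- Left cancellation `b⁻¹ (b a) = a`. -/
theorem inv_mul_mul {b : Octonion} (hb : b ≠ 0) (a : Octonion) : b⁻¹ * (b * a) = a := by
  have h := normSq_ne_zero hb
  have e := normSq_eq b
  ext <;> simp [mul_def, inv_def] <;> field_simp <;> rw [e] <;> ring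

theorem mul_ne_zero {a b : Octonion} (ha : a ≠ 0) (hb : b ≠ 0) : a * b ≠ 0 := by
  intro h
  apply ha
  rw [← mul_mul_inv hb a, h, Octonion.zero_mul]

theorem mul_inv_self {b : Octonion} (hb : b ≠ 0) : b * b⁻¹ = 1 := by
  simpa [Octonion.one_mul] using mul_mul_inv hb 1

theorem inv_ne_zero {b : Octonion} (hb : b ≠ 0) : b⁻¹ ≠ 0 := by
  intro h
  have := mul_inv_self hb
  rw [h, Octonion.mul_zero] at this
  exact one_ne_zero this.symm

theorem eq_inv_of_mul_eq_one {a b : Octonion} (hb : b ≠ 0) (h : a * b = 1) : a = b⁻¹ := by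
  rw [← mul_mul_inv hb a, h, Octonion.one_mul]

theorem normSq_mul (a b : Octonion) : normSq (a * b) = normSq a * normSq b := by
  rw [normSq_eq, normSq_eq, normSq_eq]
  simp [mul_def]
  ring

theorem mul_inv_rev (a b : Octonion) : (a * b)⁻¹ = b⁻¹ * a⁻¹ := by
  ext <;> simp [inv_def, normSq_mul] <;> simp [mul_def] <;> ring

theorem inv_inv_mul {a b : Octonion} (ha : a ≠ 0) (hb : b ≠ 0) :
    (b⁻¹ * a⁻¹) * (a * b) = 1 := by
  rw [← mul_inv_rev]
  simpa [Octonion.mul_one] using inv_mul_mul (mul_ne_zero ha hb) 1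

end Octonion

namespace OctPlane

open Octonion

/-- The relation `[a, b, c] ∼ [d, e, f]` on `𝕆³`: there is `l ≠ 0` with
`a = d l`, `b = e l`, `c = f l`. -/
def Rel (x y : Fin 3 → Octonion) : Prop :=
  ∃ l : Octonion, l ≠ 0 ∧ ∀ i, x i = y i * l

/-- The sets `U₁ = {1} × 𝕆 × 𝕆`, `U₂ = 𝕆 × {1} × 𝕆`, `U₃ = 𝕆 × 𝕆 × {1}`,
with indices shifted to `0, 1, 2`. -/
def U (i : Fin 3) : Set (Fin 3 → Octonion) := {x | x i = 1}

/-- The union `𝒰 = U₁ ∪ U₂ ∪ U₃`, a subspace of `𝕆³`. -/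
abbrev Reduced : Type := ↥(⋃ i, U i)

/-- The relation `∼` is an equivalence relation on `𝒰`. -/
theorem rel_equivalence : Equivalence (fun x y : Reduced => Rel x.1 y.1) := by
  refine ⟨fun x => ⟨1, one_ne_zero, fun i => (Octonion.mul_one _).symm⟩, ?_, ?_⟩
  · rintro x y ⟨l, hl, h⟩
    exact ⟨l⁻¹, inv_ne_zero hl, fun i => by rw [h i, mul_mul_inv hl]⟩
  · rintro ⟨x, hx⟩ ⟨y, hy⟩ ⟨z, hz⟩ ⟨l, hl, h⟩ ⟨m, hm, h'⟩
    simp only [U, Set.mem_iUnion, Set.mem_ofPred_eq] at hx hy hz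
    simp only at h h'
    obtain ⟨k, hk⟩ := hx
    obtain ⟨j, hj⟩ := hy
    obtain ⟨i, hi⟩ := hz
    refine ⟨m * l, mul_ne_zero hm hl, fun n => ?_⟩
    change x n = z n * (m * l)
    rw [h n, h' n]
    rw [h' j] at hj
    rw [h k, h' k] at hk
    have hcases : n = i ∨ n = j ∨ n = k ∨ i = j ∨ i = k ∨ j = k := by
      clear * -
      revert n i j k
      decide
    rcases hcases with rfl | rfl | rfl | rfl | rfl | rfl
    · rw [hi, Octonion.one_mul, Octonion.one_mul]
    · rw [hj, Octonion.one_mul, eq_inv_of_mul_eq_one hm hj, inv_mul_mul hm]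
    · rw [hk]
      have e : z n * m = l⁻¹ := eq_inv_of_mul_eq_one hl hk
      have e' : z n = l⁻¹ * m⁻¹ := by rw [← e, mul_mul_inv hm]
      rw [e', inv_inv_mul hm hl]
    · rw [hi, Octonion.one_mul] at hj
      rw [hj, Octonion.mul_one, Octonion.one_mul]
    · rw [hi, Octonion.one_mul] at hk
      have e : l = m⁻¹ := by rw [← inv_mul_mul hm l, hk, Octonion.mul_one]
      rw [hk, Octonion.mul_one, e, mul_mul_inv hm]
    · rw [hj, Octonion.one_mul] at hk
      rw [hk, Octonion.mul_one, Octonion.mul_one]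

/-- The equivalence relation `∼` on `𝒰`. -/
instance relSetoid : Setoid Reduced := ⟨fun x y => Rel x.1 y.1, rel_equivalence⟩

/-- The octonionic projective plane `𝕆P² = 𝒰 / ∼`. -/
def OP2 : Type := Quotient relSetoid

/-- The quotient topology. The three sets `Uᵢ` are closed in `𝒰` and cover it, so this is the same
as the topology glued from the three charts: `V` is open if and only if its preimage in
every `Uᵢ = 𝕆²` is open. -/
instance : TopologicalSpace OP2 := inferInstanceAs (TopologicalSpace (Quotient relSetoid))

/-- The class `[x 0, x 1, x 2]` of a triple that has some entry equal to `1`. -/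
def OP2.mk (x : Fin 3 → Octonion) (hx : ∃ i, x i = 1) : OP2 :=
  Quotient.mk relSetoid ⟨x, Set.mem_iUnion.2 hx⟩

/-- The subset `Uᵢ / ∼` of `𝕆P²`. -/
def dom (i : Fin 3) : Set OP2 := {p | ∃ (x : Fin 3 → Octonion) (hx : x i = 1), p = OP2.mk x ⟨i, hx⟩}

/-- The identification `𝕆 × 𝕆 = ℝ¹⁶` through the real coordinates of the quaternionic components. -/
def toR16 (a b : Octonion) : EuclideanSpace ℝ (Fin 16) :=
  !₂[a.fst.re, a.fst.imI, a.fst.imJ, a.fst.imK, a.snd.re, a.snd.imI, a.snd.imJ, a.snd.imK,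
     b.fst.re, b.fst.imI, b.fst.imJ, b.fst.imK, b.snd.re, b.snd.imI, b.snd.imJ, b.snd.imK]

/-- The map `f` between octonionic pairs, defined on the set `D` of octonionic pairs, is
the transition function from the chart `ψ` to the chart `φ` (i.e. `φ ∘ ψ⁻¹`), and `D` is its
exact domain of definition. -/
def IsTransition (φ ψ : OpenPartialHomeomorph OP2 (EuclideanSpace ℝ (Fin 16)))
    (D : Octonion → Octonion → Prop) (f : Octonion → Octonion → Octonion × Octonion) : Prop :=
  ∀ a b : Octonion, (toR16 a b ∈ (ψ.symm.trans φ).source ↔ D a b) ∧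
    (D a b → φ (ψ.symm (toR16 a b)) = toR16 (f a b).1 (f a b).2)

end OctPlane

end

open OctPlane

/-!
In the affine coordinates `xₙ xᵢ⁻¹` the class of a triple with `xᵢ ≠ 0` is determined by
the remaining two entries, so each `Uᵢ/∼` is a copy of `𝕆² = ℝ¹⁶`, and a change of charts only
involves octonionic multiplication and inversion. Since the norm is multiplicative, the functions
`|xᵢ|² / (|x₀|² + |x₁|² + |x₂|²)` are well defined on `𝕆P²`; they vanish exactly off `Uᵢ/∼`, hence
separate the points that no common chart separates. Simple connectedness follows from the
simply connected part of van Kampen's theorem: the chart domains are contractible, and two of them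
meet in a copy of `𝕆²` minus a subspace of real codimension `8`. In the same way the overlaps of
the statement are `(𝕆 ∖ 0) × 𝕆`, `(𝕆 ∖ 0) × (𝕆 ∖ 0)` and `𝕆² ∖ 0`.
-/

section SimplyConnected

open Set

variable {X : Type*} [TopologicalSpace X] {ι : Type*} {V : ι → Set X}

theorem homotopicQuotient_induction_of_isOpen_cover
    {P : ∀ ⦃x y : X⦄, Path.Homotopic.Quotient x y → Prop}
    (hVo : ∀ i, IsOpen (V i)) (hV : ∀ x, ∃ i, x ∈ V i)
    (mem : ∀ ⦃x y⦄ (i) (γ : Path x y), range γ ⊆ V i → P (.mk γ))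
    (trans : ∀ ⦃x y z⦄ (p : Path.Homotopic.Quotient x y) (q : Path.Homotopic.Quotient y z),
      P p → P q → P (p.trans q))
    {x y : X} (p : Path.Homotopic.Quotient x y) : P p := by
  induction p with | mk γ
  obtain ⟨t, ht₀, ht_mono, ⟨n, ht₁⟩, htV⟩ := exists_monotone_Icc_subset_open_cover_unitInterval
    (c := fun i => γ ⁻¹' V i) (fun i => (hVo i).preimage γ.continuous)
    (fun s _ => mem_iUnion.2 (hV (γ s)))
  have initial_segment (m : ℕ) : P (.mk (γ.subpath 0 (t m))) := by
    induction m with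
    | zero =>
      obtain ⟨i, hi⟩ := hV (γ 0)
      refine mem i _ ?_
      rw [ht₀, Path.range_subpath_of_le _ _ _ le_rfl]
      simpa using hi
    | succ m ih =>
      obtain ⟨i, hi⟩ := htV m
      have next_segment : P (.mk (γ.subpath (t m) (t (m + 1)))) := by
        refine mem i _ ?_
        rw [Path.range_subpath_of_le _ _ _ (ht_mono m.le_succ)]
        exact image_subset_iff.2 hi
      have concat : (Path.Homotopic.Quotient.mk (γ.subpath 0 (t m))).trans
          (.mk (γ.subpath (t m) (t (m + 1)))) = .mk (γ.subpath 0 (t (m + 1))) :=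
        Path.Homotopic.Quotient.eq.2 ⟨Path.Homotopy.subpathTransSubpath γ _ _ _⟩
      exact concat ▸ trans _ _ ih next_segment
  have of_cast : ∀ {a b} (ha : a = x) (hb : b = y), P (.mk (γ.cast ha hb)) → P (.mk γ) := by
    rintro _ _ rfl rfl h
    exact h
  refine of_cast γ.source γ.target ?_
  rw [← Path.subpath_zero_one, ← ht₁ n le_rfl]
  exact initial_segment n

theorem homotopic_of_range_subset_isSimplyConnected {s : Set X} (hs : IsSimplyConnected s) {x y : X}
    {p q : Path x y} (hp : range p ⊆ s) (hq : range q ⊆ s) : p.Homotopic q := by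
  have := hs.simplyConnectedSpace
  let lift (r : Path x y) (hr : range r ⊆ s) :
      Path (⟨x, hr ⟨0, r.source⟩⟩ : s) ⟨y, hr ⟨1, r.target⟩⟩ :=
    { toFun := codRestrict r s (range_subset_iff.1 hr)
      source' := Subtype.ext r.source
      target' := Subtype.ext r.target }
  exact (SimplyConnectedSpace.paths_homotopic (lift p hp) (lift q hq)).map (.restrict s (.id _))

theorem simplyConnectedSpace_of_isOpen_cover
    (hVo : ∀ i, IsOpen (V i)) (hV : ∀ x, ∃ i, x ∈ V i) (hVs : ∀ i, IsSimplyConnected (V i))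
    (hVi : ∀ i j, IsPathConnected (V i ∩ V j)) {x₀ : X} (hx₀ : ∀ i, x₀ ∈ V i) :
    SimplyConnectedSpace X := by
  have exists_path {i x} (hx : x ∈ V i) : ∃ γ : Path x₀ x, range γ ⊆ V i :=
    let h := (hVs i).isPathConnected.joinedIn x₀ (hx₀ i) x hx
    ⟨h.somePath, range_subset_iff.2 h.somePath_mem⟩
  choose k hk using id hV
  choose c hc using fun x => exists_path (hk x)
  have c_eq {i x} (γ : Path x₀ x) (hγ : range γ ⊆ V i) :
      Path.Homotopic.Quotient.mk (c x) = .mk γ := by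
    -- Both paths are homotopic to a path inside the intersection of their cover members.
    have joined := (hVi (k x) i).joinedIn x₀ ⟨hx₀ _, hx₀ _⟩ x ⟨hk x, hγ ⟨1, γ.target⟩⟩
    have hδ := range_subset_iff.2 joined.somePath_mem
    exact (Path.Homotopic.Quotient.eq.2 <|
      homotopic_of_range_subset_isSimplyConnected (hVs (k x)) (hc x)
        (hδ.trans inter_subset_left)).trans <|
        Path.Homotopic.Quotient.eq.2 <|
          homotopic_of_range_subset_isSimplyConnected (hVs i) (hδ.trans inter_subset_right) hγ
  have c_trans {x y} (p : Path.Homotopic.Quotient x y) :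
      (Path.Homotopic.Quotient.mk (c x)).trans p = .mk (c y) := by
    induction p using homotopicQuotient_induction_of_isOpen_cover hVo hV with
    | mem i γ hγ =>
      obtain ⟨δ, hδ⟩ := exists_path (hγ ⟨0, γ.source⟩)
      rw [c_eq δ hδ, ← Path.Homotopic.Quotient.mk_trans]
      exact (c_eq _ (by rw [Path.trans_range]; exact union_subset hδ hγ)).symm
    | trans p q hp hq => rw [← Path.Homotopic.Quotient.trans_assoc, hp, hq]
  have eq_symm_trans {x y} (p : Path.Homotopic.Quotient x y) :
      p = (Path.Homotopic.Quotient.mk (c x)).symm.trans (.mk (c y)) := by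
    rw [← c_trans p, ← Path.Homotopic.Quotient.trans_assoc, Path.Homotopic.Quotient.symm_trans,
      Path.Homotopic.Quotient.refl_trans]
  exact simply_connected_iff_paths_homotopic.2
    ⟨⟨⟨x₀⟩, fun x y => ⟨(c x).symm.trans (c y)⟩⟩,
      fun x y => ⟨fun p q => (eq_symm_trans p).trans (eq_symm_trans q).symm⟩⟩

end SimplyConnected

section Separation

theorem t2Space_of_continuous_of_support {ι X R : Type*} [TopologicalSpace X] [TopologicalSpace R]
    [Zero R] [T2Space R] {f : ι → X → R} (hf : ∀ i, Continuous (f i))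
    (hcover : ∀ x, ∃ i, f i x ≠ 0) (hT2 : ∀ i, T2Space (Function.support (f i))) : T2Space X := by
  refine ⟨fun x y hxy => ?_⟩
  obtain ⟨i, hx⟩ := hcover x
  by_cases hy : f i y = 0
  · exact separated_by_continuous (hf i) (hy ▸ hx)
  · have := hT2 i
    have hopen : IsOpen (Function.support (f i)) := isOpen_compl_singleton.preimage (hf i)
    exact separated_by_isOpenEmbedding hopen.isOpenEmbedding_subtypeVal
      (x := ⟨x, hx⟩) (y := ⟨y, hy⟩) (Subtype.coe_ne_coe.1 hxy)

end Separation

theorem isPathConnected_setOf_apply_ne_zero {E F : Type*} [AddCommGroup E] [Module ℝ E]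
    [TopologicalSpace E] [IsTopologicalAddGroup E] [ContinuousSMul ℝ E] [AddCommGroup F]
    [Module ℝ F] (f : E →ₗ[ℝ] F) (hf : Function.Surjective f) (hF : 1 < Module.rank ℝ F) :
    IsPathConnected {x | f x ≠ 0} := by
  have hcodim : 1 < Module.rank ℝ (E ⧸ f.ker) := by
    rwa [← Cardinal.one_lt_lift_iff, (f.quotKerEquivOfSurjective hf).lift_rank_eq,
      Cardinal.one_lt_lift_iff]
  exact isPathConnected_compl_of_one_lt_codim hcodim

/-- The homotopy equivalence between a punctured topological vector space and the unit sphere of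
a normed space isomorphic to it, by radial projection. -/
noncomputable def complZeroHomotopyEquivSphere {E F : Type*} [AddCommGroup F] [Module ℝ F]
    [TopologicalSpace F] [NormedAddCommGroup E] [NormedSpace ℝ E] (e : F ≃L[ℝ] E) :
    ContinuousMap.HomotopyEquiv ({0}ᶜ : Set F) (Metric.sphere (0 : E) 1) :=
  have : ContractibleSpace (Set.Ioi (0 : ℝ)) := (convex_Ioi 0).contractibleSpace Set.nonempty_Ioi
  let punctured : ({0}ᶜ : Set F) ≃ₜ ({0}ᶜ : Set E) :=
    e.toHomeomorph.subtype fun _ => e.map_ne_zero_iff.symm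
  (punctured.trans (homeomorphUnitSphereProd E)).toHomotopyEquiv.trans <|
    ((ContinuousMap.HomotopyEquiv.refl _).prodCongr
      (ContractibleSpace.hequiv (Set.Ioi (0 : ℝ)) Unit).some).trans
        (Homeomorph.prodPUnit _).toHomotopyEquiv

namespace Octonion

theorem inv_zero : (0 : Octonion)⁻¹ = 0 := by
  ext1 <;> simp [inv_def, zero_def]

theorem inv_inv (a : Octonion) : a⁻¹⁻¹ = a := by
  by_cases ha : a = 0
  · rw [ha, inv_zero, inv_zero]
  · exact (eq_inv_of_mul_eq_one (inv_ne_zero ha) (mul_inv_self ha)).symm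

theorem inv_one : (1 : Octonion)⁻¹ = 1 :=
  (eq_inv_of_mul_eq_one one_ne_zero (Octonion.mul_one 1)).symm

theorem mul_inv_mul {b : Octonion} (hb : b ≠ 0) (a : Octonion) : a * b⁻¹ * b = a := by
  simpa only [inv_inv] using mul_mul_inv (inv_ne_zero hb) a

theorem normSq_nonneg (a : Octonion) : 0 ≤ normSq a :=
  add_nonneg Quaternion.normSq_nonneg Quaternion.normSq_nonneg

theorem normSq_zero : normSq 0 = 0 := by simp [normSq, zero_def]

theorem normSq_one : normSq 1 = 1 := by simp [normSq, one_def]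

theorem toProd_injective : Function.Injective fun q : Octonion => (q.fst, q.snd) :=
  fun _ _ h => Octonion.ext (congrArg Prod.fst h) (congrArg Prod.snd h)

noncomputable instance : Add Octonion := ⟨fun a b => ⟨a.fst + b.fst, a.snd + b.snd⟩⟩

noncomputable instance : Neg Octonion := ⟨fun a => ⟨-a.fst, -a.snd⟩⟩

noncomputable instance : Sub Octonion := ⟨fun a b => ⟨a.fst - b.fst, a.snd - b.snd⟩⟩

noncomputable instance {R : Type*} [SMul R ℍ[ℝ]] : SMul R Octonion :=
  ⟨fun r a => ⟨r • a.fst, r • a.snd⟩⟩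

noncomputable instance : AddCommGroup Octonion :=
  toProd_injective.addCommGroup _ rfl (fun _ _ => rfl) (fun _ => rfl) (fun _ _ => rfl)
    (fun _ _ => rfl) (fun _ _ => rfl)

noncomputable instance : Module ℝ Octonion :=
  toProd_injective.module ℝ ⟨⟨fun q => (q.fst, q.snd), rfl⟩, fun _ _ => rfl⟩ fun _ _ => rfl

/-- The identification `𝕆 = ℍ ⊕ ℍ` of real vector spaces. -/
noncomputable def linearEquivProd : Octonion ≃ₗ[ℝ] ℍ[ℝ] × ℍ[ℝ] where
  toFun q := (q.fst, q.snd)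
  invFun p := ⟨p.1, p.2⟩
  map_add' _ _ := rfl
  map_smul' _ _ := rfl

/-- The identification of `𝕆` with the Euclidean product of two copies of `ℍ`. -/
noncomputable def linearEquivWithLp : Octonion ≃ₗ[ℝ] WithLp 2 (ℍ[ℝ] × ℍ[ℝ]) :=
  linearEquivProd.trans (WithLp.linearEquiv 2 ℝ (ℍ[ℝ] × ℍ[ℝ])).symm

/-- The Euclidean norm of `𝕆 = ℝ⁸`. Its topology is replaced by the propositionally equal topology
induced from `ℍ × ℍ`, which `𝕆` already carries. -/
noncomputable instance : NormedAddCommGroup Octonion :=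
  let euclidean := NormedAddCommGroup.induced Octonion _ linearEquivWithLp
    linearEquivWithLp.injective
  { euclidean with
    toMetricSpace := euclidean.toMetricSpace.replaceTopology <|
      (congrArg _ (WithLp.homeomorphProd 2 ℍ[ℝ] ℍ[ℝ]).symm.isInducing.eq_induced).trans
        induced_compose }

noncomputable instance : NormedSpace ℝ Octonion where
  norm_smul_le := (NormedSpace.induced ℝ Octonion _ linearEquivWithLp).norm_smul_le

noncomputable instance : FiniteDimensional ℝ Octonion :=
  Module.Finite.equiv linearEquivProd.symm

theorem finrank_eq_eight : Module.finrank ℝ Octonion = 8 := by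
  rw [linearEquivProd.finrank_eq, Module.finrank_prod, Quaternion.finrank_eq_four]

section ContDiff

variable {E : Type*} [NormedAddCommGroup E] [NormedSpace ℝ E] {n : WithTop ℕ∞} {s : Set E}
  {f g : E → Octonion}

theorem contDiffOn_iff :
    ContDiffOn ℝ n f s ↔
      ContDiffOn ℝ n (fun x => (f x).fst) s ∧ ContDiffOn ℝ n (fun x => (f x).snd) s := by
  rw [← linearEquivProd.toContinuousLinearEquiv.comp_contDiffOn_iff]
  exact ⟨fun h => ⟨h.fst, h.snd⟩, fun h => h.1.prodMk h.2⟩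

theorem contDiff_quaternion_star : ContDiff ℝ n (star : ℍ[ℝ] → ℍ[ℝ]) :=
  have : StarModule ℝ ℍ[ℝ] := ⟨fun r q => by simp [Quaternion.star_smul]⟩
  (starL' ℝ : ℍ[ℝ] ≃L[ℝ] ℍ[ℝ]).contDiff

theorem contDiffOn_mul (hf : ContDiffOn ℝ n f s) (hg : ContDiffOn ℝ n g s) :
    ContDiffOn ℝ n (fun x => f x * g x) s := by
  obtain ⟨hf₁, hf₂⟩ := contDiffOn_iff.1 hf
  obtain ⟨hg₁, hg₂⟩ := contDiffOn_iff.1 hg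
  exact contDiffOn_iff.2
    ⟨(hf₁.mul hg₁).sub ((contDiff_quaternion_star.comp_contDiffOn hg₂).mul hf₂),
      (hg₂.mul hf₁).add (hf₂.mul (contDiff_quaternion_star.comp_contDiffOn hg₁))⟩

theorem contDiffOn_normSq (hf : ContDiffOn ℝ n f s) : ContDiffOn ℝ n (fun x => normSq (f x)) s := by
  obtain ⟨hf₁, hf₂⟩ := contDiffOn_iff.1 hf
  simp only [normSq, Quaternion.normSq_eq_norm_mul_self, ← sq]
  exact (hf₁.norm_sq ℝ).add (hf₂.norm_sq ℝ)

theorem contDiffOn_inv (hf : ContDiffOn ℝ n f s) (hf₀ : ∀ x ∈ s, f x ≠ 0) :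
    ContDiffOn ℝ n (fun x => (f x)⁻¹) s := by
  obtain ⟨hf₁, hf₂⟩ := contDiffOn_iff.1 hf
  have hnormSq : ContDiffOn ℝ n (fun x => (normSq (f x))⁻¹) s :=
    (contDiffOn_normSq hf).inv fun x hx => normSq_ne_zero (hf₀ x hx)
  exact contDiffOn_iff.2 ⟨hnormSq.smul (contDiff_quaternion_star.comp_contDiffOn hf₁),
    (hnormSq.smul hf₂).neg⟩

end ContDiff

instance : ContinuousMul Octonion where
  continuous_mul := by
    rw [← continuousOn_univ, ← contDiffOn_zero (𝕜 := ℝ)]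
    exact contDiffOn_mul contDiffOn_fst contDiffOn_snd

theorem continuousOn_inv : ContinuousOn (fun q : Octonion => q⁻¹) {q | q ≠ 0} :=
  contDiffOn_zero (𝕜 := ℝ).1 (contDiffOn_inv contDiffOn_id fun _ hq => hq)

theorem continuous_normSq : Continuous normSq := by
  rw [← continuousOn_univ, ← contDiffOn_zero (𝕜 := ℝ)]
  exact contDiffOn_normSq contDiffOn_id

end Octonion

/-- The homeomorphism that a chart `e` onto the whole model space induces between a subset of its
source and the set of its coordinates, presented as the preimage under `e.symm`. -/
noncomputable def homeomorphOfSymmMemIff {X Y : Type*} [TopologicalSpace X] [TopologicalSpace Y]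
    (e : OpenPartialHomeomorph X Y) (he : e.target = Set.univ) {s : Set X} {t : Set Y}
    (hs : s ⊆ e.source) (h : ∀ y, e.symm y ∈ s ↔ y ∈ t) : s ≃ₜ t :=
  e.homeomorphOfImageSubsetSource hs <| by
    rw [e.image_eq_target_inter_inv_preimage hs, he, Set.univ_inter]
    exact Set.ext h

namespace OctPlane

open Octonion Set Topology

/-- The identification `𝕆² = ℝ¹⁶` of real vector spaces underlying `toR16`. -/
noncomputable def toR16Equiv : (Fin 2 → Octonion) ≃L[ℝ] EuclideanSpace ℝ (Fin 16) :=
  LinearEquiv.toContinuousLinearEquiv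
    { toFun v := toR16 (v 0) (v 1)
      invFun w := ![⟨⟨w 0, w 1, w 2, w 3⟩, ⟨w 4, w 5, w 6, w 7⟩⟩,
        ⟨⟨w 8, w 9, w 10, w 11⟩, ⟨w 12, w 13, w 14, w 15⟩⟩]
      left_inv v := by ext1 k; fin_cases k <;> rfl
      right_inv w := by ext i; fin_cases i <;> rfl
      map_add' v w := by ext i; fin_cases i <;> rfl
      map_smul' r v := by ext i; fin_cases i <;> rfl }

theorem toR16Equiv_symm_toR16 (a b : Octonion) : toR16Equiv.symm (toR16 a b) = ![a, b] :=
  toR16Equiv.symm_apply_apply ![a, b]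

theorem exists_eq_one (x : Reduced) : ∃ i, x.1 i = 1 :=
  (mem_iUnion (s := U)).1 x.2

/-- The quotient map `𝒰 → 𝕆P²`. -/
def OP2.proj : Reduced → OP2 := Quotient.mk relSetoid

theorem OP2.mk_surjective (p : OP2) : ∃ x hx, p = OP2.mk x hx := by
  obtain ⟨x, rfl⟩ := Quotient.exists_rep p
  exact ⟨x.1, exists_eq_one x, rfl⟩

theorem OP2.mk_eq_mk {x y : Fin 3 → Octonion} {hx : ∃ i, x i = 1} {hy : ∃ i, y i = 1} :
    OP2.mk x hx = OP2.mk y hy ↔ Rel x y :=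
  Quotient.eq (r := relSetoid)

theorem OP2.isQuotientMap_proj : IsQuotientMap OP2.proj :=
  isQuotientMap_quotient_mk'

theorem continuous_entry (i : Fin 3) : Continuous fun x : Reduced => x.1 i :=
  (continuous_apply i).comp continuous_subtype_val

theorem Rel.apply_eq_zero_iff {x y : Fin 3 → Octonion} (h : Rel x y) (i : Fin 3) :
    x i = 0 ↔ y i = 0 := by
  obtain ⟨l, hl, h⟩ := h
  rw [h i]
  refine ⟨fun hyl => by_contra fun hy => mul_ne_zero hy hl hyl, fun hy => ?_⟩
  rw [hy, Octonion.zero_mul]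

theorem Rel.eq_of_apply_eq_one {x y : Fin 3 → Octonion} (h : Rel x y) {i : Fin 3}
    (hx : x i = 1) (hy : y i = 1) : x = y := by
  obtain ⟨l, -, h⟩ := h
  have hl : l = 1 := by rw [← hx, h i, hy, Octonion.one_mul]
  funext n
  rw [h n, hl, Octonion.mul_one]

theorem rel_mul_inv {x : Fin 3 → Octonion} {i : Fin 3} (hi : x i ≠ 0) :
    Rel x fun n => x n * (x i)⁻¹ :=
  ⟨x i, hi, fun _ => (mul_inv_mul hi _).symm⟩

/-- Without associativity this rests on the transitivity of `∼`, which only holds on `𝒰`. -/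
theorem Rel.mul_inv_eq {x y : Fin 3 → Octonion} (h : Rel x y) (hx : ∃ i, x i = 1)
    (hy : ∃ i, y i = 1) (i n : Fin 3) : x n * (x i)⁻¹ = y n * (y i)⁻¹ := by
  by_cases hxi : x i = 0
  · rw [hxi, (h.apply_eq_zero_iff i).1 hxi, inv_zero, Octonion.mul_zero, Octonion.mul_zero]
  have hyi : y i ≠ 0 := mt (h.apply_eq_zero_iff i).2 hxi
  have hx' : x i * (x i)⁻¹ = 1 := mul_inv_self hxi
  have hy' : y i * (y i)⁻¹ = 1 := mul_inv_self hyi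
  have mk_eq : OP2.mk (fun n => x n * (x i)⁻¹) ⟨i, hx'⟩ =
      OP2.mk (fun n => y n * (y i)⁻¹) ⟨i, hy'⟩ :=
    calc
      _ = OP2.mk x hx := (OP2.mk_eq_mk.2 (rel_mul_inv hxi)).symm
      _ = OP2.mk y hy := OP2.mk_eq_mk.2 h
      _ = _ := OP2.mk_eq_mk.2 (rel_mul_inv hyi)
  exact congrFun ((OP2.mk_eq_mk.1 mk_eq).eq_of_apply_eq_one hx' hy') n

/-- The affine coordinate `xₙ xᵢ⁻¹`. Off `Uᵢ/∼` it takes the junk value `0`. -/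
noncomputable def ratio (i n : Fin 3) : OP2 → Octonion :=
  Quotient.lift (fun x : Reduced => x.1 n * (x.1 i)⁻¹) fun x y (h : Rel x.1 y.1) =>
    h.mul_inv_eq (exists_eq_one x) (exists_eq_one y) i n

theorem ratio_mk (i n : Fin 3) (x : Fin 3 → Octonion) (hx : ∃ i, x i = 1) :
    ratio i n (OP2.mk x hx) = x n * (x i)⁻¹ := rfl

theorem mk_mem_dom {i : Fin 3} {x : Fin 3 → Octonion} {hx : ∃ i, x i = 1} :
    OP2.mk x hx ∈ dom i ↔ x i ≠ 0 := by
  constructor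
  · rintro ⟨y, hy, h⟩
    rw [Ne, (OP2.mk_eq_mk.1 h).apply_eq_zero_iff, hy]
    exact one_ne_zero
  · exact fun h => ⟨fun n => x n * (x i)⁻¹, mul_inv_self h, OP2.mk_eq_mk.2 (rel_mul_inv h)⟩

theorem exists_mem_dom (p : OP2) : ∃ i, p ∈ dom i := by
  obtain ⟨x, ⟨i, hi⟩, rfl⟩ := p.mk_surjective
  exact ⟨i, mk_mem_dom.2 (hi ▸ one_ne_zero)⟩

theorem preimage_dom (i : Fin 3) : OP2.proj ⁻¹' dom i = {x | x.1 i ≠ 0} :=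
  Set.ext fun x => mk_mem_dom (hx := exists_eq_one x)

theorem isOpen_dom (i : Fin 3) : IsOpen (dom i) := by
  rw [← OP2.isQuotientMap_proj.isOpen_preimage, preimage_dom]
  exact isOpen_compl_singleton.preimage (continuous_entry i)

theorem continuousOn_ratio (i n : Fin 3) : ContinuousOn (ratio i n) (dom i) := by
  rw [OP2.isQuotientMap_proj.continuousOn_isOpen_iff (isOpen_dom i), preimage_dom]
  exact (continuous_entry n).continuousOn.mul
    (continuousOn_inv.comp (continuous_entry i).continuousOn fun _ h => h)

/-- The triple in `Uᵢ` with the entries of `v` in the remaining places. -/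
noncomputable def insertOne (i : Fin 3) (v : Fin 2 → Octonion) : Fin 3 → Octonion :=
  i.insertNth (α := fun _ => Octonion) 1 v

theorem insertOne_self (i : Fin 3) (v : Fin 2 → Octonion) : insertOne i v i = 1 :=
  Fin.insertNth_apply_same ..

theorem insertOne_succAbove (i : Fin 3) (v : Fin 2 → Octonion) (k : Fin 2) :
    insertOne i v (i.succAbove k) = v k :=
  Fin.insertNth_apply_succAbove ..

theorem insertOne_zero (a b : Octonion) : insertOne 0 ![a, b] = ![1, a, b] := by
  funext n; fin_cases n <;> rfl

theorem insertOne_one (a b : Octonion) : insertOne 1 ![a, b] = ![a, 1, b] := by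
  funext n; fin_cases n <;> rfl

theorem insertOne_two (a b : Octonion) : insertOne 2 ![a, b] = ![a, b, 1] := by
  funext n; fin_cases n <;> rfl

theorem contDiff_insertOne (i n : Fin 3) (m : WithTop ℕ∞) :
    ContDiff ℝ m fun v => insertOne i v n := by
  revert n
  simp only [i.forall_iff_succAbove, insertOne_self, insertOne_succAbove]
  exact ⟨contDiff_const, contDiff_apply ℝ Octonion⟩

theorem continuous_insertOne (i : Fin 3) : Continuous (insertOne i) :=
  continuous_pi fun n => (contDiff_insertOne i n 0).continuous

/-- The chart `Uᵢ/∼ → 𝕆²`. -/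
noncomputable def affineChart (i : Fin 3) : OpenPartialHomeomorph OP2 (Fin 2 → Octonion) where
  toFun p k := ratio i (i.succAbove k) p
  invFun v := OP2.mk (insertOne i v) ⟨i, insertOne_self i v⟩
  source := dom i
  target := univ
  map_source' _ _ := mem_univ _
  map_target' v _ := ⟨insertOne i v, insertOne_self i v, rfl⟩
  left_inv' := by
    rintro _ ⟨x, hx, rfl⟩
    refine congrArg OP2.proj (Subtype.ext (funext ?_))
    simp only [ratio_mk, hx, inv_one, Octonion.mul_one]
    exact i.forall_iff_succAbove.2 ⟨(insertOne_self _ _).trans hx.symm, insertOne_succAbove _ _⟩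
  right_inv' v _ := by
    simp only [ratio_mk, insertOne_self, insertOne_succAbove, inv_one, Octonion.mul_one]
  open_source := isOpen_dom i
  open_target := isOpen_univ
  continuousOn_toFun := continuousOn_pi.2 fun _ => continuousOn_ratio _ _
  continuousOn_invFun := (OP2.isQuotientMap_proj.continuous.comp <|
    (continuous_insertOne i).subtype_mk fun v =>
      mem_iUnion.2 ⟨i, insertOne_self i v⟩).continuousOn

theorem affineChart_symm_mem_dom {i j : Fin 3} {v : Fin 2 → Octonion} :
    (affineChart j).symm v ∈ dom i ↔ insertOne j v i ≠ 0 :=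
  mk_mem_dom (hx := ⟨j, insertOne_self j v⟩)

/-- The chart `φᵢ : Uᵢ/∼ → ℝ¹⁶`. -/
noncomputable def chart (i : Fin 3) : OpenPartialHomeomorph OP2 (EuclideanSpace ℝ (Fin 16)) :=
  (affineChart i).transHomeomorph toR16Equiv.toHomeomorph

theorem chart_source (i : Fin 3) : (chart i).source = dom i := rfl

theorem chart_target (i : Fin 3) : (chart i).target = univ := rfl

theorem transition_source (i j : Fin 3) : ((chart j).symm.trans (chart i)).source =
    {w | insertOne j (toR16Equiv.symm w) i ≠ 0} := by
  rw [OpenPartialHomeomorph.trans_source, OpenPartialHomeomorph.symm_source, chart_target,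
    univ_inter, chart_source]
  exact Set.ext fun w => affineChart_symm_mem_dom

theorem chart_mk_insertOne (i : Fin 3) (a b : Octonion) :
    chart i (OP2.mk (insertOne i ![a, b]) ⟨i, insertOne_self i _⟩) = toR16 a b :=
  congrArg toR16Equiv ((affineChart i).right_inv (mem_univ ![a, b]))

theorem isTransition_chart (i j : Fin 3) :
    IsTransition (chart i) (chart j) (fun a b => insertOne j ![a, b] i ≠ 0) fun a b =>
      (insertOne j ![a, b] (i.succAbove 0) * (insertOne j ![a, b] i)⁻¹,
        insertOne j ![a, b] (i.succAbove 1) * (insertOne j ![a, b] i)⁻¹) := by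
  refine fun a b => ⟨?_, fun _ => rfl⟩
  rw [transition_source, mem_ofPred_eq, toR16Equiv_symm_toR16]

theorem contDiffOn_transition (i j : Fin 3) (m : WithTop ℕ∞) :
    ContDiffOn ℝ m ((chart j).symm.trans (chart i)) ((chart j).symm.trans (chart i)).source := by
  have entry (n : Fin 3) : ContDiff ℝ m fun w => insertOne j (toR16Equiv.symm w) n :=
    (contDiff_insertOne j n m).comp toR16Equiv.symm.contDiff
  rw [transition_source]
  exact toR16Equiv.contDiff.comp_contDiffOn <| contDiffOn_pi.2 fun k =>
    contDiffOn_mul (entry (i.succAbove k)).contDiffOn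
      (contDiffOn_inv (entry i).contDiffOn fun _ hw => hw)

/-- The charted space structure with atlas `φ₀, φ₁, φ₂`. -/
@[reducible]
noncomputable def chartedSpace : ChartedSpace (EuclideanSpace ℝ (Fin 16)) OP2 where
  atlas := range chart
  chartAt p := chart (exists_mem_dom p).choose
  mem_chart_source p := (exists_mem_dom p).choose_spec
  chart_mem_atlas _ := mem_range_self _

theorem isManifold : @IsManifold ℝ _ _ _ _ _ _ (𝓡 16) ∞ OP2 _ chartedSpace := by
  let _ := chartedSpace
  apply isManifold_of_contDiffOn
  rintro _ _ ⟨i, rfl⟩ ⟨j, rfl⟩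
  simpa using contDiffOn_transition j i ∞

theorem sum_normSq_ne_zero {x : Fin 3 → Octonion} (hx : ∃ i, x i = 1) :
    ∑ j, normSq (x j) ≠ 0 := by
  obtain ⟨i, hi⟩ := hx
  have le_sum : normSq (x i) ≤ ∑ j, normSq (x j) :=
    Finset.single_le_sum (fun j _ => normSq_nonneg (x j)) (Finset.mem_univ i)
  rw [hi, normSq_one] at le_sum
  exact (zero_lt_one.trans_le le_sum).ne'

/-- The function `|xᵢ|² / (|x₀|² + |x₁|² + |x₂|²)` on the projective plane. -/
noncomputable def weight (i : Fin 3) : OP2 → ℝ :=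
  Quotient.lift (fun x : Reduced => normSq (x.1 i) / ∑ j, normSq (x.1 j)) fun x y => by
    rintro ⟨l, hl, h⟩
    simp only [h, normSq_mul, ← Finset.sum_mul]
    exact mul_div_mul_right _ _ (normSq_ne_zero hl)

theorem continuous_weight (i : Fin 3) : Continuous (weight i) := by
  have continuous_normSq_entry (j) : Continuous fun x : Reduced => normSq (x.1 j) :=
    continuous_normSq.comp (continuous_entry j)
  rw [OP2.isQuotientMap_proj.continuous_iff]
  exact (continuous_normSq_entry i).div
    (continuous_finsetSum _ fun j _ => continuous_normSq_entry j)
    fun x => sum_normSq_ne_zero (exists_eq_one x)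

theorem support_weight (i : Fin 3) : Function.support (weight i) = dom i := by
  ext p
  obtain ⟨x, hx, rfl⟩ := p.mk_surjective
  rw [mk_mem_dom, Function.mem_support]
  change normSq (x i) / ∑ j, normSq (x j) ≠ 0 ↔ _
  rw [div_ne_zero_iff, and_iff_left (sum_normSq_ne_zero hx)]
  exact ⟨mt fun h => h ▸ normSq_zero, normSq_ne_zero⟩

instance : T2Space OP2 :=
  t2Space_of_continuous_of_support continuous_weight
    (fun p => (exists_mem_dom p).imp fun i hi => by rwa [← support_weight] at hi)
    fun i => support_weight i ▸ (chart i).toHomeomorphSourceTarget.isEmbedding.t2Space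

instance : SecondCountableTopology OP2 :=
  have (i : Fin 3) : SecondCountableTopology (dom i) :=
    (chart i).toHomeomorphSourceTarget.isEmbedding.secondCountableTopology
  TopologicalSpace.secondCountableTopology_of_countable_cover isOpen_dom
    (eq_univ_of_forall fun p => mem_iUnion.2 (exists_mem_dom p))

theorem isSimplyConnected_dom (i : Fin 3) : IsSimplyConnected (dom i) :=
  ((chart i).toHomeomorphSourceTarget.trans
    (Homeomorph.Set.univ _)).toHomotopyEquiv.simplyConnectedSpace

theorem isPathConnected_setOf_insertOne_ne_zero (i j : Fin 3) :
    IsPathConnected {v | insertOne j v i ≠ 0} := by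
  have one_lt_rank : 1 < Module.rank ℝ Octonion := by
    rw [← Module.finrank_eq_rank, finrank_eq_eight]
    norm_num
  revert i
  simp only [j.forall_iff_succAbove, insertOne_self, insertOne_succAbove]
  refine ⟨?_, fun k => isPathConnected_setOf_apply_ne_zero
    (LinearMap.proj (φ := fun _ => Octonion) k) (Function.surjective_eval k) one_lt_rank⟩
  simpa [one_ne_zero] using isPathConnected_univ

theorem isPathConnected_dom_inter (i j : Fin 3) : IsPathConnected (dom i ∩ dom j) := by
  let e : (dom i ∩ dom j : Set OP2) ≃ₜ {v | insertOne j v i ≠ 0} :=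
    homeomorphOfSymmMemIff (affineChart j) rfl inter_subset_right fun v => by
      simp [affineChart_symm_mem_dom, insertOne_self, one_ne_zero]
  have := isPathConnected_iff_pathConnectedSpace.1 (isPathConnected_setOf_insertOne_ne_zero i j)
  exact isPathConnected_iff_pathConnectedSpace.2
    (e.symm.surjective.pathConnectedSpace e.symm.continuous)

instance : SimplyConnectedSpace OP2 :=
  simplyConnectedSpace_of_isOpen_cover isOpen_dom exists_mem_dom isSimplyConnected_dom
    isPathConnected_dom_inter (x₀ := OP2.mk (fun _ => 1) ⟨0, rfl⟩)
      fun _ => mk_mem_dom.2 one_ne_zero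

/-- The identification `𝕆 = ℝ⁸`, chosen arbitrarily. -/
noncomputable def toR8Equiv : Octonion ≃L[ℝ] EuclideanSpace ℝ (Fin 8) :=
  .ofFinrankEq (by rw [finrank_eq_eight, finrank_euclideanSpace_fin])

theorem nonempty_homotopyEquiv_dom_zero_inter_dom_one :
    Nonempty (ContinuousMap.HomotopyEquiv (dom 0 ∩ dom 1 : Set OP2)
      (Metric.sphere (0 : EuclideanSpace ℝ (Fin 8)) 1 × EuclideanSpace ℝ (Fin 8))) := by
  let e : (dom 0 ∩ dom 1 : Set OP2) ≃ₜ ({0}ᶜ ×ˢ univ : Set (Octonion × Octonion)) :=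
    homeomorphOfSymmMemIff ((affineChart 0).transHomeomorph .finTwoArrow) rfl inter_subset_left
      fun v => by simp [affineChart_symm_mem_dom, insertOne_zero, one_ne_zero]
  exact ⟨(e.trans (Homeomorph.Set.prod _ _)).toHomotopyEquiv.trans
    ((complZeroHomotopyEquivSphere toR8Equiv).prodCongr
      ((Homeomorph.Set.univ _).trans toR8Equiv.toHomeomorph).toHomotopyEquiv)⟩

theorem nonempty_homotopyEquiv_dom_inter_dom_inter_dom :
    Nonempty (ContinuousMap.HomotopyEquiv (dom 0 ∩ dom 1 ∩ dom 2 : Set OP2)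
      (Metric.sphere (0 : EuclideanSpace ℝ (Fin 8)) 1 ×
        Metric.sphere (0 : EuclideanSpace ℝ (Fin 8)) 1)) := by
  let e : (dom 0 ∩ dom 1 ∩ dom 2 : Set OP2) ≃ₜ ({0}ᶜ ×ˢ {0}ᶜ : Set (Octonion × Octonion)) :=
    homeomorphOfSymmMemIff ((affineChart 0).transHomeomorph .finTwoArrow) rfl
      (inter_subset_left.trans inter_subset_left) fun v => by
        simp [affineChart_symm_mem_dom, insertOne_zero, one_ne_zero]
  exact ⟨(e.trans (Homeomorph.Set.prod _ _)).toHomotopyEquiv.trans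
    ((complZeroHomotopyEquivSphere toR8Equiv).prodCongr
      (complZeroHomotopyEquivSphere toR8Equiv))⟩

theorem nonempty_homotopyEquiv_union_dom_inter_dom_two :
    Nonempty (ContinuousMap.HomotopyEquiv ((dom 0 ∪ dom 1) ∩ dom 2 : Set OP2)
      (Metric.sphere (0 : EuclideanSpace ℝ (Fin 16)) 1)) := by
  let e : ((dom 0 ∪ dom 1) ∩ dom 2 : Set OP2) ≃ₜ ({0}ᶜ : Set (Fin 2 → Octonion)) :=
    homeomorphOfSymmMemIff (affineChart 2) rfl inter_subset_right fun v => by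
      obtain ⟨a, b, rfl⟩ : ∃ a b, v = ![a, b] := ⟨v 0, v 1, by ext1 k; fin_cases k <;> rfl⟩
      simp [affineChart_symm_mem_dom, insertOne_two, one_ne_zero, imp_iff_not_or]
  exact ⟨e.toHomotopyEquiv.trans (complZeroHomotopyEquivSphere toR16Equiv)⟩

end OctPlane

theorem mainTheorem7 :
    -- the three charts `φᵢ : Uᵢ/∼ → ℝ¹⁶`, homeomorphisms from open sets onto `ℝ¹⁶`
    (∃ φ : Fin 3 → OpenPartialHomeomorph OP2 (EuclideanSpace ℝ (Fin 16)),
      (∀ i, (φ i).source = dom i) ∧ (∀ i, (φ i).target = Set.univ) ∧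
      (∀ b c : Octonion, φ 0 (OP2.mk ![1, b, c] ⟨0, rfl⟩) = toR16 b c) ∧
      (∀ a c : Octonion, φ 1 (OP2.mk ![a, 1, c] ⟨1, rfl⟩) = toR16 a c) ∧
      (∀ a b : Octonion, φ 2 (OP2.mk ![a, b, 1] ⟨2, rfl⟩) = toR16 a b) ∧
      -- the transition functions `φᵢ ∘ φⱼ⁻¹`
      IsTransition (φ 0) (φ 1) (fun a _ => a ≠ 0) (fun a b => (a⁻¹, b * a⁻¹)) ∧
      IsTransition (φ 1) (φ 0) (fun a _ => a ≠ 0) (fun a b => (a⁻¹, b * a⁻¹)) ∧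
      IsTransition (φ 0) (φ 2) (fun a _ => a ≠ 0) (fun a b => (b * a⁻¹, a⁻¹)) ∧
      IsTransition (φ 2) (φ 0) (fun _ b => b ≠ 0) (fun a b => (b⁻¹, a * b⁻¹)) ∧
      IsTransition (φ 1) (φ 2) (fun _ b => b ≠ 0) (fun a b => (a * b⁻¹, b⁻¹)) ∧
      IsTransition (φ 2) (φ 1) (fun _ b => b ≠ 0) (fun a b => (a * b⁻¹, b⁻¹)) ∧
      -- they form an atlas of a smooth 16-dimensional manifold
      ∃ _ : ChartedSpace (EuclideanSpace ℝ (Fin 16)) OP2,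
        atlas (EuclideanSpace ℝ (Fin 16)) OP2 = Set.range φ ∧ IsManifold (𝓡 16) ∞ OP2) ∧
    T2Space OP2 ∧ SecondCountableTopology OP2 ∧
    SimplyConnectedSpace OP2 ∧
    -- homotopy types of the overlaps of the chart domains
    Nonempty (ContinuousMap.HomotopyEquiv (dom 0 ∩ dom 1 : Set OP2)
      (Metric.sphere (0 : EuclideanSpace ℝ (Fin 8)) 1 × EuclideanSpace ℝ (Fin 8))) ∧
    Nonempty (ContinuousMap.HomotopyEquiv (dom 0 ∩ dom 1 ∩ dom 2 : Set OP2)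
      (Metric.sphere (0 : EuclideanSpace ℝ (Fin 8)) 1 ×
        Metric.sphere (0 : EuclideanSpace ℝ (Fin 8)) 1)) ∧
    Nonempty (ContinuousMap.HomotopyEquiv ((dom 0 ∪ dom 1) ∩ dom 2 : Set OP2)
      (Metric.sphere (0 : EuclideanSpace ℝ (Fin 16)) 1)) := by
  refine ⟨⟨chart, chart_source, chart_target, fun b c => ?_, fun a c => ?_, fun a b => ?_,
    ?_, ?_, ?_, ?_, ?_, ?_, chartedSpace, rfl, isManifold⟩, inferInstance, inferInstance,
    inferInstance, nonempty_homotopyEquiv_dom_zero_inter_dom_one,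
    nonempty_homotopyEquiv_dom_inter_dom_inter_dom,
    nonempty_homotopyEquiv_union_dom_inter_dom_two⟩
  · simpa only [insertOne_zero] using chart_mk_insertOne 0 b c
  · simpa only [insertOne_one] using chart_mk_insertOne 1 a c
  · simpa only [insertOne_two] using chart_mk_insertOne 2 a b
  · simpa [insertOne_one, Octonion.one_mul, Fin.succAbove] using isTransition_chart 0 1
  · simpa [insertOne_zero, Octonion.one_mul, Fin.succAbove] using isTransition_chart 1 0
  · simpa [insertOne_two, Octonion.one_mul, Fin.succAbove] using isTransition_chart 0 2
  · simpa [insertOne_zero, Octonion.one_mul, Fin.succAbove] using isTransition_chart 2 0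
  · simpa [insertOne_two, Octonion.one_mul, Fin.succAbove] using isTransition_chart 1 2
  · simpa [insertOne_one, Octonion.one_mul, Fin.succAbove] using isTransition_chart 2 1
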